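/- Let $d\ge 2$ and $\gamma>d$. Let $\mu_d$ be the isometry-invariant measure on the space of affine lines of $\mathbb{R}^d$, normalized so that the measure of the set $[K]$ of lines meeting a convex body $K$ is $\tfrac12 m_{d-1}(\partial K)$, where $m_{d-1}$ is the $(d-1)$-dimensional Hausdorff measure. Let $\Pi$ be a Poisson point process of marked lines $(l,v)$, $v>0$, with intensity measure $\mathrm{d}\mu_d(l)\,(\gamma-1)v^{-\gamma}\,\mathrm{d}v$; the mark $v$ is the speed limit on $l$. For a set $\Gamma$ of marked lines, a (finite-time) $\Gamma$-path is a locally Lipschitz map $\xi:[0,T]\to\mathbb{R}^d$, $0\le T<\infty$, such that for almost every $t$ either $\xi'(t)=0$ or $(\xi(t)+\mathbb{R}\xi'(t),v)\in\Gamma$ for some $v\ge|\xi'(t)|$. Let $T^{\Gamma}_{xy}\in[0,\infty]$ be the infimum of the durations $T$ of $\Gamma$-paths from $x$ to $y$, and $T_{xy}=T^{\Pi}_{xy}$. Let $\delta>0$ and $\eta>\gamma-1$. Then for any two distinct points $x,y\in\mathbb{R}^d$, $$\mathbb{E}\bigl[\exp(\delta\, T_{xy}^{\eta})\bigr]=\infty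 .$$ Consequently the exponent $\gamma-1$ cannot be improved in moment bounds $\mathbb{E}[\exp(\delta\,T_{A,F}^{\gamma-1})]<\infty$ on diameters: for any sets $A,F\subset\mathbb{R}^d$ with $A$ containing at least two points, and any $\rho>0$, let $A^\rho$ be the set of points at distance less than $\rho$ from $A$, let $\Gamma$ be the set of $(l,v)\in\Pi$ such that $l$ meets $A^{\rho}$ but not $F$, and let $T_{A,F}=\sup_{x,y\in A}T^{\Gamma}_{xy}$. Then $\mathbb{E}[\exp(\delta\,T_{A,F}^{\eta})]=\infty$. -/

import Mathlib

open MeasureTheory ProbabilityTheory Set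
open scoped NNReal ENNReal RealInnerProductSpace

namespace PoissonRoads

noncomputable section

/-- Euclidean space `ℝ^d`. -/
abbrev E (d : ℕ) : Type := EuclideanSpace ℝ (Fin d)

/-- The space of (undirected) affine lines of `ℝ^d`. -/
def Line (d : ℕ) : Type := {l : AffineSubspace ℝ (E d) // Module.finrank ℝ l.direction = 1}

/-- The line `p + ℝ u` through the point `p`, directed by the nonzero vector `u`. -/
def lineThrough {d : ℕ} (p u : E d) (hu : u ≠ 0) : Line d :=
  ⟨AffineSubspace.mk' p (Submodule.span ℝ {u}), by
    rw [AffineSubspace.direction_mk']; exact finrank_span_singleton hu⟩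

/-- The hitting set `[A]`: all the lines that meet `A`. -/
def hitting {d : ℕ} (A : Set (E d)) : Set (Line d) :=
  {l | ((l.1 : Set (E d)) ∩ A).Nonempty}

/-- The usual σ-algebra on the space of lines, generated by the hitting sets of compact sets. -/
instance (d : ℕ) : MeasurableSpace (Line d) :=
  MeasurableSpace.generateFrom {S | ∃ K : Set (E d), IsCompact K ∧ S = hitting K}

theorem sphere_ne_zero {d : ℕ} (u : Metric.sphere (0 : E d) 1) : (u : E d) ≠ 0 := by
  intro h
  have h1 := u.2
  rw [h] at h1
  simp at h1

theorem mem_hitting_lineThrough {d : ℕ} (K : Set (E d)) (z u : E d) (hu : u ≠ 0) :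
    lineThrough z u hu ∈ hitting K ↔ ∃ t : ℝ, z + t • u ∈ K := by
  constructor
  · rintro ⟨k, hk, hkK⟩
    have h : k ∈ AffineSubspace.mk' z (Submodule.span ℝ {u}) := hk
    rw [AffineSubspace.mem_mk', Submodule.mem_span_singleton] at h
    obtain ⟨t, ht⟩ := h
    refine ⟨t, ?_⟩
    rw [ht, vsub_eq_sub, add_sub_cancel]
    exact hkK
  · rintro ⟨t, ht⟩
    refine ⟨z + t • u, ?_, ht⟩
    change z + t • u ∈ AffineSubspace.mk' z (Submodule.span ℝ {u})
    rw [AffineSubspace.mem_mk', Submodule.mem_span_singleton]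
    exact ⟨t, by simp⟩

/-- The map `(u, z) ↦ z + ℝ u` is measurable. -/
theorem measurable_lineThrough (d : ℕ) :
    Measurable (fun q : Metric.sphere (0 : E d) 1 × E d =>
      lineThrough q.2 (q.1 : E d) (sphere_ne_zero q.1)) := by
  refine measurable_generateFrom ?_
  rintro S ⟨K, hK, rfl⟩
  apply IsClosed.measurableSet
  have : CompactSpace K := isCompact_iff_compactSpace.mp hK
  have hcl : IsClosed {q : (Metric.sphere (0 : E d) 1 × E d) × K |
      ((q.2 : E d) - q.1.2) - ⟪(q.1.1 : E d), (q.2 : E d) - q.1.2⟫ • (q.1.1 : E d) = 0} :=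
    isClosed_eq (by fun_prop) (by fun_prop)
  have h2 := isClosedMap_fst_of_compactSpace _ hcl
  convert h2 using 1
  ext ⟨u, z⟩
  rw [mem_preimage, mem_hitting_lineThrough]
  have hu : ⟪(u : E d), (u : E d)⟫ = 1 := by
    have := u.2
    rw [mem_sphere_zero_iff_norm] at this
    rw [real_inner_self_eq_norm_sq, this, one_pow]
  constructor
  · rintro ⟨t, ht⟩
    refine ⟨((u, z), ⟨z + t • (u : E d), ht⟩), ?_, rfl⟩
    simp [inner_smul_right]
  · rintro ⟨⟨⟨u', z'⟩, k⟩, hk, h⟩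
    simp only [Prod.mk.injEq] at h
    obtain ⟨rfl, rfl⟩ := h
    refine ⟨⟪(u' : E d), (k : E d) - z'⟫, ?_⟩
    have hk' : ((k : E d) - z') - ⟪(u' : E d), (k : E d) - z'⟫ • (u' : E d) = 0 := hk
    rw [← sub_eq_zero.mp hk', add_sub_cancel]
    exact k.2

/-- The image, under `p ↦ p + ℝ u`, of the `(d-1)`-dimensional Lebesgue measure of the hyperplane
through the origin normal to `u`: a measure on the lines of direction `u`. -/
def parallelMeasure (d : ℕ) (u : Metric.sphere (0 : E d) 1) : Measure (Line d) :=
  (volume : Measure ((Submodule.span ℝ {(u : E d)})ᗮ)).map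
    (fun p : (Submodule.span ℝ {(u : E d)})ᗮ =>
      lineThrough (p : E d) (u : E d) (sphere_ne_zero u))

theorem measurePreserving_add_orthogonal {d : ℕ} (V : Submodule ℝ (E d)) :
    MeasurePreserving (fun q : V × Vᗮ => (q.1 : E d) + (q.2 : E d)) := by
  have h := V.orthogonalDecomposition.symm.measurePreserving.comp
    (WithLp.volume_preserving_toLp V Vᗮ)
  have h' : (V.orthogonalDecomposition.symm ∘ WithLp.toLp 2 : V × Vᗮ → E d) =
      fun q : V × Vᗮ => (q.1 : E d) + (q.2 : E d) := by
    funext q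
    simp
  rwa [h'] at h

theorem volume_unit_segment {d : ℕ} (u : E d) (hun : ‖u‖ = 1) :
    volume {a : Submodule.span ℝ {u} | ⟪u, (a : E d)⟫ ∈ Icc (0 : ℝ) 1} = 1 := by
  have hA : MeasurableSet {a : Submodule.span ℝ {u} | ⟪u, (a : E d)⟫ ∈ Icc (0 : ℝ) 1} :=
    measurableSet_Icc.preimage (by fun_prop)
  have := (LinearIsometryEquiv.toSpanUnitSingleton (𝕜 := ℝ) u hun).measurePreserving
  rw [← this.measure_preimage hA.nullMeasurableSet]
  have h2 : (LinearIsometryEquiv.toSpanUnitSingleton (𝕜 := ℝ) u hun) ⁻¹'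
      {a : Submodule.span ℝ {u} | ⟪u, (a : E d)⟫ ∈ Icc (0 : ℝ) 1} = Icc (0 : ℝ) 1 := by
    ext t
    simp [inner_smul_right, hun]
  rw [h2]
  simp

theorem lineThrough_smul_add {d : ℕ} (p u : E d) (hu : u ≠ 0) (t : ℝ) :
    lineThrough (t • u + p) u hu = lineThrough p u hu := by
  apply Subtype.ext
  change AffineSubspace.mk' _ _ = AffineSubspace.mk' _ _
  ext q
  rw [AffineSubspace.mem_mk', AffineSubspace.mem_mk', vsub_eq_sub, vsub_eq_sub]
  have ht : t • u ∈ Submodule.span ℝ {u} :=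
    Submodule.smul_mem _ _ (Submodule.mem_span_singleton_self _)
  rw [← sub_sub, sub_right_comm]
  exact Submodule.sub_mem_iff_left _ ht

/-- The measure `parallelMeasure d u` evaluated through the slab `0 ≤ ⟪u, z⟫ ≤ 1`. -/
theorem parallelMeasure_apply (d : ℕ) (u : Metric.sphere (0 : E d) 1) {S : Set (Line d)}
    (hS : MeasurableSet S) :
    parallelMeasure d u S = volume {z : E d | ⟪(u : E d), z⟫ ∈ Icc (0 : ℝ) 1 ∧
      lineThrough z (u : E d) (sphere_ne_zero u) ∈ S} := by
  have hun : ‖(u : E d)‖ = 1 := mem_sphere_zero_iff_norm.mp u.2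
  have hmeas : Measurable (fun z : E d => lineThrough z (u : E d) (sphere_ne_zero u)) :=
    Measurable.comp (g := fun q : Metric.sphere (0 : E d) 1 × E d =>
      lineThrough q.2 (q.1 : E d) (sphere_ne_zero q.1)) (f := fun z => (u, z))
      (measurable_lineThrough d) measurable_prodMk_left
  have hslab : MeasurableSet {z : E d | ⟪(u : E d), z⟫ ∈ Icc (0 : ℝ) 1 ∧
      lineThrough z (u : E d) (sphere_ne_zero u) ∈ S} :=
    (measurableSet_Icc.preimage (f := fun z : E d => ⟪(u : E d), z⟫) (by fun_prop)).inter
      (hmeas hS)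
  have h3 : (fun q : Submodule.span ℝ {(u : E d)} × (Submodule.span ℝ {(u : E d)})ᗮ =>
        (q.1 : E d) + (q.2 : E d)) ⁻¹'
      {z : E d | ⟪(u : E d), z⟫ ∈ Icc (0 : ℝ) 1 ∧
        lineThrough z (u : E d) (sphere_ne_zero u) ∈ S} =
      {a : Submodule.span ℝ {(u : E d)} | ⟪(u : E d), (a : E d)⟫ ∈ Icc (0 : ℝ) 1} ×ˢ
      {p : (Submodule.span ℝ {(u : E d)})ᗮ |
        lineThrough (p : E d) (u : E d) (sphere_ne_zero u) ∈ S} := by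
    ext ⟨⟨a, ha⟩, p⟩
    obtain ⟨t, rfl⟩ := Submodule.mem_span_singleton.mp ha
    have hp : ⟪(u : E d), (p : E d)⟫ = 0 :=
      Submodule.mem_orthogonal_singleton_iff_inner_right.mp p.2
    simp only [mem_preimage, mem_ofPred_eq, mem_prod, lineThrough_smul_add, inner_add_right, hp,
      add_zero]
  have h4 := (measurePreserving_add_orthogonal
    (Submodule.span ℝ {(u : E d)})).measure_preimage hslab.nullMeasurableSet
  rw [h3, Measure.volume_eq_prod] at h4
  have h5 := h4.symm.trans (Measure.prod_prod _ _)
  rw [volume_unit_segment _ hun, one_mul] at h5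
  have h6 := Measure.map_apply (μ := (volume : Measure ((Submodule.span ℝ {(u : E d)})ᗮ)))
    (hmeas.comp measurable_subtype_coe) hS
  exact h6.trans h5.symm

theorem measurable_parallelMeasure (d : ℕ) : Measurable (parallelMeasure d) := by
  refine Measure.measurable_of_measurable_coe _ fun S hS => ?_
  simp_rw [parallelMeasure_apply d _ hS]
  have hm : MeasurableSet {q : Metric.sphere (0 : E d) 1 × E d |
      ⟪(q.1 : E d), q.2⟫ ∈ Icc (0 : ℝ) 1 ∧
        lineThrough q.2 (q.1 : E d) (sphere_ne_zero q.1) ∈ S} := by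
    refine MeasurableSet.inter ?_ (measurable_lineThrough d hS)
    exact measurableSet_Icc.preimage (by fun_prop)
  exact measurable_measure_prodMk_left hm

/-- The invariant line measure `μ_d`: direction distributed according to the surface measure of
the unit sphere (halved, since opposite vectors give the same direction), position distributed
according to Lebesgue measure on the hyperplane normal to the direction, and a normalisation by the
volume of the unit ball of `ℝ^(d-1)`, so that `μ_d [K]` is half of the area of the boundary of `K`
for a convex body `K`. -/
def lineMeasure (d : ℕ) : Measure (Line d) :=
  (2 * volume (Metric.ball (0 : E (d - 1)) 1))⁻¹ •
    ((volume : Measure (E d)).toSphere).bind (parallelMeasure d)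

theorem lineMeasure_apply (d : ℕ) {S : Set (Line d)} (hS : MeasurableSet S) :
    lineMeasure d S = (2 * volume (Metric.ball (0 : E (d - 1)) 1))⁻¹ *
      ∫⁻ u, parallelMeasure d u S ∂(volume : Measure (E d)).toSphere := by
  rw [lineMeasure, Measure.smul_apply, smul_eq_mul,
    Measure.bind_apply hS (measurable_parallelMeasure d).aemeasurable]

/-- The intensity measure `dμ_d(l) (γ - 1) v^(-γ) dv`, `v > 0`, on lines marked with a speed. -/
def markedLineMeasure (d : ℕ) (γ : ℝ) : Measure (Line d × ℝ) :=
  (lineMeasure d).prod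
    ((volume.restrict (Ioi (0 : ℝ))).withDensity (fun v => ENNReal.ofReal ((γ - 1) * v ^ (-γ))))

/-- `N` is a Poisson point process with intensity measure `Λ`, as a random set of points on the
probability space `(Ω, P)`: the number of points in a measurable set `B` has the Poisson law of
parameter `Λ B` (which means that it is a.s. infinite if `Λ B = ∞`), and the numbers of points in
disjoint measurable sets are independent. -/
structure IsPoissonProcess {Ω X : Type*} [MeasurableSpace Ω] [MeasurableSpace X]
    (P : Measure Ω) (Λ : Measure X) (N : Ω → Set X) : Prop where
  hasLaw : ∀ B : Set X, MeasurableSet B → Λ B ≠ ∞ →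
    HasLaw (fun ω => (N ω ∩ B).encard)
      ((poissonMeasure (Λ B).toNNReal).map (fun n : ℕ => (n : ℕ∞))) P
  infinite : ∀ B : Set X, MeasurableSet B → Λ B = ∞ → ∀ᵐ ω ∂P, (N ω ∩ B).encard = ⊤
  indep : ∀ (n : ℕ) (B : Fin n → Set X), (∀ i, MeasurableSet (B i)) →
    Pairwise (fun i j => Disjoint (B i) (B j)) →
    iIndepFun (fun i ω => (N ω ∩ B i).encard) P

/-- `ξ : [0, T] → ℝ^d` is a (finite-time) path respecting the speed limits of the set `Γ` of marked
lines: it is locally Lipschitz, and at almost every time `t` either it has speed zero or it follows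
a line `ξ t + ℝ ξ'(t)` of `Γ` whose mark is at least `‖ξ'(t)‖`. (Only the values of `ξ` on
`[0, T]` matter.) -/
structure IsRoadPath {d : ℕ} (Γ : Set (Line d × ℝ)) (T : ℝ≥0) (ξ : ℝ → E d) : Prop where
  locallyLipschitzOn : LocallyLipschitzOn (Icc (0 : ℝ) T) ξ
  speed : ∀ᵐ t ∂(volume.restrict (Icc (0 : ℝ) T)), ∃ w : E d, HasDerivAt ξ w t ∧
    (w = 0 ∨ ∃ (hw : w ≠ 0) (v : ℝ), ‖w‖ ≤ v ∧ (lineThrough (ξ t) w hw, v) ∈ Γ)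

/-- The time distance `T_{ab}` for the set `Γ` of marked lines: the infimum of the durations of the
paths from `a` to `b` that respect the speed limits (`∞` if there are none). -/
def timeDist {d : ℕ} (Γ : Set (Line d × ℝ)) (a b : E d) : ℝ≥0∞ :=
  ⨅ (T : ℝ≥0) (ξ : ℝ → E d) (_ : IsRoadPath Γ T ξ ∧ ξ 0 = a ∧ ξ T = b), (T : ℝ≥0∞)

/-- The marked lines of `Γ` whose line belongs to `L`. -/
def restrictLines {d : ℕ} (Γ : Set (Line d × ℝ)) (L : Set (Line d)) : Set (Line d × ℝ) :=
  {q ∈ Γ | q.1 ∈ L}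

/-- The time diameter of the set `A` for the set `Γ` of marked lines. -/
def timeDiam {d : ℕ} (Γ : Set (Line d × ℝ)) (A : Set (E d)) : ℝ≥0∞ :=
  ⨆ (x ∈ A) (y ∈ A), timeDist Γ x y

/-- The value `exp (δ t^η) ∈ [0, ∞]` for `t ∈ [0, ∞]`. -/
def expPow (δ η : ℝ) (t : ℝ≥0∞) : ℝ≥0∞ :=
  EReal.exp ((ENNReal.ofReal δ * t ^ η : ℝ≥0∞) : EReal)

end

end PoissonRoads

open PoissonRoads

namespace PoissonRoads

/-! ### Road paths inside a region with a speed limit -/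

/-! Slow travel is forced by one void event. Put `r = dist x y`. If no line with mark above `r / t`
meets the closed ball of centre `x` and radius `r`, every path from `x` to `y` needs time at least
`t` just to reach the boundary of the ball (`le_timeDist`). The number of such fast lines is Poisson
with finite mean `c * t ^ (γ - 1)`, so the event has probability `exp (-c * t ^ (γ - 1))`
(`IsPoissonProcess.measure_void`). Hence the moment is at least `exp (δ * t ^ η - c * t ^ (γ - 1))`
for every `t > 0` (`lintegral_expPow_timeDist_ge`), which is unbounded because `η > γ - 1`. For
diameters, deleting lines can only lengthen travel times. -/

theorem IsRoadPath.mono {d : ℕ} {Γ Γ' : Set (Line d × ℝ)} (h : Γ ⊆ Γ') {T : ℝ≥0} {ξ : ℝ → E d}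
    (hξ : IsRoadPath Γ T ξ) : IsRoadPath Γ' T ξ where
  locallyLipschitzOn := hξ.locallyLipschitzOn
  speed := by
    filter_upwards [hξ.speed] with t ht
    obtain ⟨w, hw, h0 | ⟨hw0, v, hv, hΓ⟩⟩ := ht
    · exact ⟨w, hw, Or.inl h0⟩
    · exact ⟨w, hw, Or.inr ⟨hw0, v, hv, h hΓ⟩⟩

theorem timeDist_anti {d : ℕ} {Γ Γ' : Set (Line d × ℝ)} (h : Γ ⊆ Γ') (a b : E d) :
    timeDist Γ' a b ≤ timeDist Γ a b := by
  refine le_iInf₂ fun T ξ => le_iInf fun hξ => ?_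
  exact iInf₂_le_of_le T ξ (iInf_le_of_le ⟨hξ.1.mono h, hξ.2⟩ le_rfl)

/-- As long as a road path stays in `K`, its speed is bounded by the marks of the lines
meeting `K`. -/
theorem IsRoadPath.norm_sub_le {d : ℕ} {Γ : Set (Line d × ℝ)} {T : ℝ≥0} {ξ : ℝ → E d}
    (hξ : IsRoadPath Γ T ξ) {K : Set (E d)} {v : ℝ} (hv : 0 ≤ v)
    (hΓ : ∀ q ∈ Γ, q.1 ∈ hitting K → q.2 ≤ v) {s : ℝ} (hs : 0 ≤ s) (hsT : s ≤ T)
    (hK : ∀ t ∈ Ico 0 s, ξ t ∈ K) : ‖ξ s - ξ 0‖ ≤ v * s := by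
  -- Projecting onto the total displacement `e` reduces to a real Lipschitz function, for which the
  -- fundamental theorem of calculus gives `‖e‖ ^ 2 ≤ ‖e‖ * v * s`.
  set e := ξ s - ξ 0 with he
  obtain ⟨C, hC⟩ := hξ.locallyLipschitzOn.exists_lipschitzOnWith_of_compact isCompact_Icc
  have hsub : uIcc 0 s ⊆ Icc (0 : ℝ) T := by
    rw [uIcc_of_le hs]; exact Icc_subset_Icc_right hsT
  have hlip : LipschitzOnWith (‖innerSL ℝ e‖₊ * C) (fun t => ⟪e, ξ t⟫) (uIcc 0 s) :=
    (innerSL ℝ e).lipschitz.comp_lipschitzOnWith (hC.mono hsub)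
  have hint := hlip.absolutelyContinuousOnInterval.integral_deriv_eq_sub
  have hbound : ∀ᵐ t, t ∈ uIoc 0 s → ‖deriv (fun t => ⟪e, ξ t⟫) t‖ ≤ ‖e‖ * v := by
    have h1 := (ae_restrict_iff' measurableSet_Icc).mp hξ.speed
    -- The path is only known to lie in `K` strictly before time `s`.
    have h2 : ∀ᵐ t : ℝ, t ≠ s := by simp [ae_iff, measure_singleton]
    filter_upwards [h1, h2] with t ht hts hmem
    rw [uIoc_of_le hs] at hmem
    obtain ⟨w, hw, hwv⟩ := ht ⟨hmem.1.le, hmem.2.trans hsT⟩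
    have hd : HasDerivAt (fun t => ⟪e, ξ t⟫) ⟪e, w⟫ t :=
      (innerSL ℝ e).hasFDerivAt.comp_hasDerivAt t hw
    rw [hd.deriv]
    refine (norm_inner_le_norm _ _).trans (mul_le_mul_of_nonneg_left ?_ (norm_nonneg _))
    rcases hwv with rfl | ⟨hw0, c, hwc, hc⟩
    · simpa using hv
    · refine hwc.trans (hΓ _ hc ?_)
      rw [mem_hitting_lineThrough]
      exact ⟨0, by simpa using hK t ⟨hmem.1.le, lt_of_le_of_ne hmem.2 hts⟩⟩
  have hle := intervalIntegral.norm_integral_le_of_norm_le_const_ae hbound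
  rw [hint, ← inner_sub_right, ← he, real_inner_self_eq_norm_sq, sub_zero, abs_of_nonneg hs,
    Real.norm_of_nonneg (sq_nonneg _)] at hle
  rcases (norm_nonneg e).eq_or_lt with h0 | hpos
  · rw [← h0]; positivity
  · nlinarith

/-- If every line of `Γ` meeting the ball centred at `x` through `y` has mark at most `v`, then
travelling from `x` to `y` takes time at least `dist x y / v`. -/
theorem le_timeDist {d : ℕ} {Γ : Set (Line d × ℝ)} {x y : E d} {v : ℝ} (hv : 0 < v)
    (hΓ : ∀ q ∈ Γ, q.1 ∈ hitting (Metric.closedBall x (dist x y)) → q.2 ≤ v) :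
    ENNReal.ofReal (dist x y / v) ≤ timeDist Γ x y := by
  refine le_iInf₂ fun T ξ => le_iInf fun ⟨hξ, h0, hT⟩ => ?_
  have hcont : ContinuousOn (fun t => dist x (ξ t)) (Icc (0 : ℝ) T) :=
    (continuous_const.dist continuous_id).comp_continuousOn hξ.locallyLipschitzOn.continuousOn
  -- `s` is the first time at distance at least `dist x y` from `x`; before it the path stays in the
  -- ball.
  obtain ⟨s, ⟨hs, hsr⟩, hmin⟩ := (isCompact_Icc.of_isClosed_subset
    (hcont.preimage_isClosed_of_isClosed isClosed_Icc (isClosed_Ici (a := dist x y)))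
    inter_subset_left).exists_isLeast ⟨T, ⟨⟨T.2, le_rfl⟩, by simp [hT]⟩⟩
  have hbd := hξ.norm_sub_le hv.le hΓ hs.1 hs.2 fun t ht => by
    rw [Metric.mem_closedBall']
    by_contra! hlt
    exact absurd (hmin ⟨⟨ht.1, ht.2.le.trans hs.2⟩, hlt.le⟩) (not_le.mpr ht.2)
  rw [h0, ← dist_eq_norm, dist_comm] at hbd
  have hsr' : dist x y ≤ dist x (ξ s) := hsr
  rw [← ENNReal.ofReal_coe_nnreal]
  refine ENNReal.ofReal_le_ofReal ((div_le_iff₀ hv).mpr ?_)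
  have := mul_le_mul_of_nonneg_left hs.2 hv.le
  linarith

/-! ### The intensity of fast lines meeting a ball -/

theorem measurableSet_hitting {d : ℕ} {K : Set (E d)} (hK : IsCompact K) :
    MeasurableSet (hitting K) :=
  MeasurableSpace.measurableSet_generateFrom ⟨K, hK, rfl⟩

/-- If `z` lies in the unit slab and `z + t • u` in the ball, pairing with `u` bounds `|t|`, so `z`
is confined to a larger ball. Its radius does not depend on `u`, which allows integration over
directions. -/
theorem parallelMeasure_hitting_closedBall_le {d : ℕ} (u : Metric.sphere (0 : E d) 1) (x : E d)
    (r : ℝ) :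
    parallelMeasure d u (hitting (Metric.closedBall x r)) ≤
      volume (Metric.closedBall x (r + (1 + ‖x‖ + (‖x‖ + r)))) := by
  rw [parallelMeasure_apply d u (measurableSet_hitting (isCompact_closedBall x r))]
  refine measure_mono ?_
  rintro z ⟨hz, hl⟩
  obtain ⟨t, ht⟩ := (mem_hitting_lineThrough _ _ _ _).mp hl
  have hun : ‖(u : E d)‖ = 1 := mem_sphere_zero_iff_norm.mp u.2
  have hk : ‖z + t • (u : E d)‖ ≤ ‖x‖ + r := by
    rw [mem_closedBall_iff_norm] at ht
    calc ‖z + t • (u : E d)‖ = ‖x + (z + t • (u : E d) - x)‖ := by congr 1; abel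
      _ ≤ ‖x‖ + r := (norm_add_le _ _).trans (by linarith)
  have hin := abs_real_inner_le_norm (u : E d) (z + t • (u : E d))
  rw [inner_add_right, inner_smul_right, real_inner_self_eq_norm_sq, hun, one_pow, mul_one,
    one_mul] at hin
  have htb : |t| ≤ 1 + ‖x‖ + (‖x‖ + r) := by
    have := norm_nonneg x
    rw [abs_le] at hin ⊢
    constructor <;> linarith [hin.1, hin.2, hz.1, hz.2]
  rw [mem_closedBall_iff_norm] at ht ⊢
  calc ‖z - x‖ = ‖(z + t • (u : E d) - x) - t • (u : E d)‖ := by congr 1; abel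
    _ ≤ r + (1 + ‖x‖ + (‖x‖ + r)) := by
      refine (norm_sub_le _ _).trans (add_le_add ht ?_)
      rwa [norm_smul, hun, mul_one]

theorem lineMeasure_hitting_closedBall_ne_top (d : ℕ) (x : E d) (r : ℝ) :
    lineMeasure d (hitting (Metric.closedBall x r)) ≠ ∞ := by
  rw [lineMeasure_apply d (measurableSet_hitting (isCompact_closedBall x r))]
  refine ENNReal.mul_ne_top ?_ ?_
  · refine ENNReal.inv_ne_top.mpr (mul_ne_zero two_ne_zero ?_)
    exact (Metric.measure_ball_pos volume _ one_pos).ne'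
  · refine ((lintegral_mono fun u => parallelMeasure_hitting_closedBall_le u x r).trans_lt ?_).ne
    rw [lintegral_const]
    exact ENNReal.mul_lt_top (isCompact_closedBall _ _).measure_lt_top (measure_lt_top _ _)

theorem withDensity_rpow_Ioi {γ : ℝ} (hγ : 1 < γ) {v : ℝ} (hv : 0 < v) :
    (volume.restrict (Ioi (0 : ℝ))).withDensity
      (fun v => ENNReal.ofReal ((γ - 1) * v ^ (-γ))) (Ioi v) = ENNReal.ofReal (v ^ (1 - γ)) := by
  rw [withDensity_apply _ measurableSet_Ioi, Measure.restrict_restrict measurableSet_Ioi,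
    inter_eq_left.mpr (Ioi_subset_Ioi hv.le), ← ofReal_integral_eq_lintegral_ofReal]
  · rw [integral_const_mul, integral_Ioi_rpow_of_lt (by linarith) hv]
    have h : γ - 1 ≠ 0 := by linarith
    rw [show -γ + 1 = -(γ - 1) by ring, show 1 - γ = -(γ - 1) by ring]
    field_simp
  · exact (integrableOn_Ioi_rpow_of_lt (by linarith) hv).const_mul _
  · filter_upwards [ae_restrict_mem measurableSet_Ioi] with t ht
    have : 0 < t := hv.trans ht
    have : 0 ≤ γ - 1 := by linarith
    positivity

theorem markedLineMeasure_hitting_prod_Ioi (d : ℕ) {γ : ℝ} (hγ : 1 < γ) (x : E d) (r : ℝ) {v : ℝ}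
    (hv : 0 < v) :
    markedLineMeasure d γ (hitting (Metric.closedBall x r) ×ˢ Ioi v) = ENNReal.ofReal
      ((lineMeasure d (hitting (Metric.closedBall x r))).toReal * v ^ (1 - γ)) := by
  rw [markedLineMeasure, Measure.prod_prod, withDensity_rpow_Ioi hγ hv,
    ENNReal.ofReal_mul ENNReal.toReal_nonneg,
    ENNReal.ofReal_toReal (lineMeasure_hitting_closedBall_ne_top d x r)]

/-! ### Void probabilities and exponential moments -/

/-- The law of a count provides only a.e. measurability, hence null measurability of the void event;
this suffices to integrate its indicator. -/
theorem IsPoissonProcess.nullMeasurableSet_void {Ω X : Type*} [MeasurableSpace Ω]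
    [MeasurableSpace X] {P : Measure Ω} {Λ : Measure X} {N : Ω → Set X}
    (hN : IsPoissonProcess P Λ N) {B : Set X} (hB : MeasurableSet B) (hΛ : Λ B ≠ ∞) :
    NullMeasurableSet {ω | N ω ∩ B = ∅} P := by
  have h := (hN.hasLaw B hB hΛ).aemeasurable.nullMeasurable (measurableSet_singleton 0)
  convert h using 1
  ext ω
  simp

theorem IsPoissonProcess.measure_void {Ω X : Type*} [MeasurableSpace Ω] [MeasurableSpace X]
    {P : Measure Ω} {Λ : Measure X} {N : Ω → Set X} (hN : IsPoissonProcess P Λ N) {B : Set X}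
    (hB : MeasurableSet B) (hΛ : Λ B ≠ ∞) :
    P {ω | N ω ∩ B = ∅} = ENNReal.ofReal (Real.exp (-(Λ B).toReal)) := by
  have h := (hN.hasLaw B hB hΛ).measure_eq (p := fun n => n = 0) (measurableSet_singleton 0)
  simp only [encard_eq_zero] at h
  rw [h, ofPred_eq_eq_singleton, Measure.map_apply .of_discrete (measurableSet_singleton _),
    show (fun n : ℕ => (n : ℕ∞)) ⁻¹' {0} = {0} by ext; simp, poissonMeasure_singleton]
  simp [ENNReal.toReal]

theorem expPow_mono {δ η : ℝ} (hη : 0 ≤ η) : Monotone (expPow δ η) := by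
  intro s t h
  refine EReal.exp_monotone (EReal.coe_ennreal_le_coe_ennreal_iff.mpr ?_)
  gcongr

theorem expPow_ofReal {δ η t : ℝ} (hδ : 0 ≤ δ) (hη : 0 ≤ η) (ht : 0 ≤ t) :
    expPow δ η (ENNReal.ofReal t) = ENNReal.ofReal (Real.exp (δ * t ^ η)) := by
  rw [expPow, ENNReal.ofReal_rpow_of_nonneg ht hη, ← ENNReal.ofReal_mul hδ,
    EReal.coe_ennreal_ofReal, max_eq_left (by positivity), EReal.exp_coe]

theorem tendsto_mul_rpow_sub_mul_rpow_atTop {δ η α : ℝ} (C : ℝ) (hδ : 0 < δ) (hα : 0 < α)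
    (hη : α < η) :
    Filter.Tendsto (fun t : ℝ => δ * t ^ η - C * t ^ α) Filter.atTop Filter.atTop := by
  have h1 : Filter.Tendsto (fun t : ℝ => δ * t ^ (η - α) - C) Filter.atTop Filter.atTop :=
    Filter.tendsto_atTop_add_const_right _ _
      ((tendsto_rpow_atTop (sub_pos.mpr hη)).const_mul_atTop hδ)
  refine ((tendsto_rpow_atTop hα).atTop_mul_atTop₀ h1).congr' ?_
  -- For `t > 0` the difference factors as `t ^ α * (δ * t ^ (η - α) - C)`.
  filter_upwards [Filter.eventually_gt_atTop 0] with t ht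
  rw [mul_sub, mul_left_comm, ← Real.rpow_add ht, add_sub_cancel, mul_comm C]

theorem lintegral_expPow_timeDist_ge {d : ℕ} {γ : ℝ} (hγ : 1 < γ)
    {Ω : Type*} [MeasurableSpace Ω] {P : Measure Ω} {N : Ω → Set (Line d × ℝ)}
    (hN : IsPoissonProcess P (markedLineMeasure d γ) N) {δ η : ℝ} (hδ : 0 ≤ δ) (hη : 0 ≤ η)
    {x y : E d} (hxy : x ≠ y) {t : ℝ} (ht : 0 < t) :
    ENNReal.ofReal (Real.exp (δ * t ^ η -
      (lineMeasure d (hitting (Metric.closedBall x (dist x y)))).toReal *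
        dist x y ^ (1 - γ) * t ^ (γ - 1))) ≤ ∫⁻ ω, expPow δ η (timeDist (N ω) x y) ∂P := by
  have hr : 0 < dist x y := dist_pos.mpr hxy
  have hv : 0 < dist x y / t := div_pos hr ht
  -- The speed threshold is chosen so that covering `dist x y` takes time exactly `t`.
  set B := hitting (Metric.closedBall x (dist x y)) ×ˢ Ioi (dist x y / t) with hB
  have hBm : MeasurableSet B :=
    (measurableSet_hitting (isCompact_closedBall _ _)).prod measurableSet_Ioi
  have hΛ := markedLineMeasure_hitting_prod_Ioi d hγ x (dist x y) hv
  rw [← hB] at hΛ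
  have hΛt : markedLineMeasure d γ B ≠ ∞ := hΛ ▸ ENNReal.ofReal_ne_top
  have hle : ∀ ω ∈ {ω | N ω ∩ B = ∅},
      ENNReal.ofReal (Real.exp (δ * t ^ η)) ≤ expPow δ η (timeDist (N ω) x y) := by
    intro ω hω
    rw [← expPow_ofReal hδ hη ht.le]
    refine expPow_mono hη ?_
    have h := le_timeDist (Γ := N ω) (x := x) (y := y) hv fun q hq hqK => by
      by_contra! hlt
      have : q ∈ N ω ∩ B := ⟨hq, hqK, hlt⟩
      rw [mem_ofPred_eq.mp hω] at this
      exact this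
    rwa [div_div_cancel₀ hr.ne'] at h
  calc _ = ENNReal.ofReal (Real.exp (δ * t ^ η)) * P {ω | N ω ∩ B = ∅} := by
        rw [hN.measure_void hBm hΛt, ← ENNReal.ofReal_mul (Real.exp_pos _).le, ← Real.exp_add, hΛ,
          ENNReal.toReal_ofReal (mul_nonneg ENNReal.toReal_nonneg (by positivity)),
          Real.div_rpow hr.le ht.le, div_eq_mul_inv, ← Real.rpow_neg ht.le, neg_sub,
          ← sub_eq_add_neg, mul_assoc]
    _ = ∫⁻ ω, {ω | N ω ∩ B = ∅}.indicator
          (fun _ => ENNReal.ofReal (Real.exp (δ * t ^ η))) ω ∂P :=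
        (lintegral_indicator_const₀ (hN.nullMeasurableSet_void hBm hΛt) _).symm
    -- Monotonicity of the lower integral needs no measurability of the travel time.
    _ ≤ _ := lintegral_mono fun ω => indicator_le hle ω

theorem lintegral_expPow_timeDist_eq_top {d : ℕ} {γ : ℝ} (hγ : 1 < γ)
    {Ω : Type*} [MeasurableSpace Ω] {P : Measure Ω} {N : Ω → Set (Line d × ℝ)}
    (hN : IsPoissonProcess P (markedLineMeasure d γ) N) {δ η : ℝ} (hδ : 0 < δ) (hη : γ - 1 < η)
    {x y : E d} (hxy : x ≠ y) : ∫⁻ ω, expPow δ η (timeDist (N ω) x y) ∂P = ∞ := by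
  have htend := ENNReal.tendsto_ofReal_atTop.comp (Real.tendsto_exp_atTop.comp
    (tendsto_mul_rpow_sub_mul_rpow_atTop
      ((lineMeasure d (hitting (Metric.closedBall x (dist x y)))).toReal * dist x y ^ (1 - γ))
      hδ (sub_pos.mpr hγ) hη))
  refine top_le_iff.mp (le_of_tendsto htend ?_)
  filter_upwards [Filter.eventually_gt_atTop 0] with t ht
  exact lintegral_expPow_timeDist_ge hγ hN hδ.le (by linarith) hxy ht

end PoissonRoads

theorem mainTheorem9 (d : ℕ) (hd : 2 ≤ d) (γ : ℝ) (hγ : (d : ℝ) < γ)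
    {Ω : Type*} [MeasurableSpace Ω] (P : Measure Ω) [IsProbabilityMeasure P]
    (N : Ω → Set (Line d × ℝ)) (hN : IsPoissonProcess P (markedLineMeasure d γ) N)
    (δ : ℝ) (hδ : 0 < δ) (η : ℝ) (hη : γ - 1 < η) :
    (∀ x y : E d, x ≠ y → ∫⁻ ω, expPow δ η (timeDist (N ω) x y) ∂P = ∞) ∧
    (∀ A F : Set (E d), A.Nontrivial → ∀ ρ : ℝ, 0 < ρ →
      ∫⁻ ω, expPow δ η
        (timeDiam (restrictLines (N ω) (hitting (Metric.thickening ρ A) \ hitting F)) A) ∂P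
          = ∞) := by
  have hd' : (2 : ℝ) ≤ d := by exact_mod_cast hd
  have hγ1 : 1 < γ := by linarith
  refine ⟨fun x y hxy => lintegral_expPow_timeDist_eq_top hγ1 hN hδ hη hxy, ?_⟩
  rintro A F ⟨x, hx, y, hy, hxy⟩ ρ -
  refine top_le_iff.mp ?_
  -- It suffices to dominate, pointwise in `ω`, the unrestricted travel time between two distinct
  -- points of `A`.
  rw [← lintegral_expPow_timeDist_eq_top hγ1 hN hδ hη hxy]
  refine lintegral_mono fun ω => expPow_mono (by linarith) ?_
  have hsub : restrictLines (N ω) (hitting (Metric.thickening ρ A) \ hitting F) ⊆ N ω :=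
    sep_subset _ _
  refine (timeDist_anti hsub x y).trans ?_
  exact le_iSup₂_of_le x hx (le_iSup₂_of_le y hy le_rfl)
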